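/- Let $\mathcal H$ be a real Hilbert space, let $n\ge 2$, let $A_1,\dots,A_n\colon\mathcal H\rightrightarrows\mathcal H$ be maximally monotone set-valued operators, let $L>0$, and let $B_1,\dots,B_{n-1}\colon\mathcal H\to\mathcal H$ be $\frac1L$-cocoercive, i.e. $\langle B_i(x)-B_i(y),x-y\rangle\ge\frac1L\|B_i(x)-B_i(y)\|^2$ for all $x,y\in\mathcal H$. Write $J_{\lambda A}=(\mathrm{Id}+\lambda A)^{-1}$ for the resolvent, $\operatorname{zer}C=\{x: 0\in C(x)\}$ and $\operatorname{Fix}C=\{x: x\in C(x)\}$. Assume that $$\operatorname{zer}\Bigl(\sum_{i=1}^nA_i+\sum_{i=1}^{n-1}B_i\Bigr)\neq\varnothing,$$ and let $\lambda\in\bigl(0,\frac2L\bigr)$ and $\gamma\in\bigl(0,1-\frac{\lambda L}2\bigr)$. Let $T\colon\mathcal H^{n-1}\to\mathcal H^{n-1}$ be the operator $T(\mathbf z)=\mathbf z+\gamma\,(x_2-x_1,\,x_3-x_2,\,\dots,\,x_n-x_{n-1})$, where $\mathbf x=(x_1,\dots,x_n)\in\mathcal H^n$ depends on $\mathbf z=(z_1,\dots,z_{n-1})$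 through $$\begin{cases}x_1=J_{\lambda A_1}(z_1),\\ x_i=J_{\lambda A_i}\bigl(z_i+x_{i-1}-z_{i-1}-\lambda B_{i-1}(x_{i-1})\bigr)\quad (2\le i\le n-1),\\ x_n=J_{\lambda A_n}\bigl(x_1+x_{n-1}-z_{n-1}-\lambda B_{n-1}(x_{n-1})\bigr).\end{cases}\tag{1}$$ Then, for every $\mathbf z^0\in\mathcal H^{n-1}$, there is exactly one pair of sequences $(\mathbf z^k)_{k\ge0}\subseteq\mathcal H^{n-1}$ starting at $\mathbf z^0$ and $(\mathbf x^k)_{k\ge0}\subseteq\mathcal H^n$ such that, for every $k$, the vector $\mathbf x^k$ is obtained from $\mathbf z^k$ by (1) and $\mathbf z^{k+1}=\mathbf z^k+\gamma\,(x_2^k-x_1^k,\dots,x_n^k-x_{n-1}^k)$. Moreover: (a) $(\mathbf z^k)$ converges weakly to a point $\mathbf z\in\operatorname{Fix}T$. There is a point $x\in\operatorname{zer}\bigl(\sum_{i=1}^nA_i+\sum_{i=1}^{n-1}B_i\bigr)$ such that (b) $(\mathbf x^k)$ converges weakly to $(x,\dots,x)\in\mathcal H^n$, and (c) $B_i(x_i^k)\to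 B_i(x)$ strongly as $k\to\infty$, for every $i\in\{1,\dots,n-1\}$. -/

import Mathlib

open scoped Pointwise Topology RealInnerProductSpace

namespace DFB

section Operators

variable {H : Type*}

/-- A set-valued operator `A : H ⇉ H` is a map `H → Set H`; this is its graph. -/
def graph (A : H → Set H) : Set (H × H) := {p | p.2 ∈ A p.1}

/-- The set-valued inverse: `x ∈ A⁻¹ u ↔ u ∈ A x`. -/
def inverse (A : H → Set H) : H → Set H := fun u => {x | u ∈ A x}

/-- A single-valued map, viewed as a set-valued operator. -/
def ofMap (B : H → H) : H → Set H := fun x => {B x}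

/-- The set of zeros of a set-valued operator. -/
def zer [Zero H] (A : H → Set H) : Set H := {x | 0 ∈ A x}

/-- The set of fixed points of a set-valued operator. -/
def fix (A : H → Set H) : Set H := {x | x ∈ A x}

variable [NormedAddCommGroup H] [InnerProductSpace ℝ H]

/-- Monotonicity of a set-valued operator. -/
def IsMonotone (A : H → Set H) : Prop :=
  ∀ x y u v : H, (x, u) ∈ graph A → (y, v) ∈ graph A → 0 ≤ ⟪x - y, u - v⟫

/-- Maximal monotonicity: no monotone operator has a graph properly containing that of `A`. -/
def IsMaximallyMonotone (A : H → Set H) : Prop :=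
  IsMonotone A ∧ ¬ ∃ C : H → Set H, IsMonotone C ∧ graph A ⊂ graph C

/-- `c`-cocoercivity of a single-valued operator. -/
def IsCocoercive (c : ℝ) (B : H → H) : Prop :=
  ∀ x y : H, c * ‖B x - B y‖ ^ 2 ≤ ⟪B x - B y, x - y⟫

/-- The resolvent `J_{tA} = (Id + t A)⁻¹`, as a set-valued operator; the sum and the
scalar multiple of operators are the pointwise Minkowski ones. -/
def resolventOp (t : ℝ) (A : H → Set H) : H → Set H := inverse (ofMap id + t • A)

end Operators

/-- Weak convergence of a sequence. -/
def ConvergesWeakly {E : Type*} [NormedAddCommGroup E] [NormedSpace ℝ E]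
    (u : ℕ → E) (l : E) : Prop :=
  Filter.Tendsto (fun k => toWeakSpace ℝ E (u k)) Filter.atTop (𝓝 (toWeakSpace ℝ E l))

/-- The Hilbert space `H ^ m` (with the `ℓ²` product norm). -/
abbrev Power (H : Type*) (m : ℕ) : Type _ := PiLp 2 (fun _ : Fin m => H)

section Algorithm

variable {H : Type*} [NormedAddCommGroup H] [InnerProductSpace ℝ H] {m : ℕ}

/-- The operator `A_1 + ⋯ + A_n + B_1 + ⋯ + B_{n-1}`, where `n = m + 1`. -/
def sumOperator (A : Fin (m + 1) → H → Set H) (B : Fin m → H → H) : H → Set H :=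
  (∑ i, A i) + (∑ i, ofMap (B i))

/-- The relation between `z ∈ H ^ (n - 1)` and `x ∈ H ^ n`, where `n = m + 1`
and indices start at `0`:
`x_1 = J(z_1)`, `x_i = J(z_i + x_{i-1} - z_{i-1} - t B_{i-1} x_{i-1})` for `2 ≤ i ≤ n - 1`, and
`x_n = J(x_1 + x_{n-1} - z_{n-1} - t B_{n-1} x_{n-1})`, each `J` being the resolvent of the
operator `A` with the same index as the left-hand side. -/
structure IsResolventStep (A : Fin (m + 1) → H → Set H) (B : Fin m → H → H) (t : ℝ)
    (z : Power H m) (x : Power H (m + 1)) : Prop where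
  first : ∀ i : Fin m, (i : ℕ) = 0 → x i.castSucc ∈ resolventOp t (A i.castSucc) (z i)
  middle : ∀ i j : Fin m, (j : ℕ) = (i : ℕ) + 1 →
    x j.castSucc ∈ resolventOp t (A j.castSucc)
      (z j + x i.castSucc - z i - t • B i (x i.castSucc))
  last : ∀ i : Fin m, (i : ℕ) + 1 = m →
    x (Fin.last m) ∈ resolventOp t (A (Fin.last m))
      (x 0 + x i.castSucc - z i - t • B i (x i.castSucc))

/-- `z + γ (x_2 - x_1, …, x_n - x_{n-1})`. -/
noncomputable def update (γ : ℝ) (z : Power H m) (x : Power H (m + 1)) : Power H m :=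
  z + γ • WithLp.toLp 2 (fun i : Fin m => x i.succ - x i.castSucc)

/-- The operator `T` on `H ^ (n - 1)`, as a set-valued operator. -/
def T (A : Fin (m + 1) → H → Set H) (B : Fin m → H → H) (t γ : ℝ) :
    Power H m → Set (Power H m) :=
  fun z => {w | ∃ x : Power H (m + 1), IsResolventStep A B t z x ∧ w = update γ z x}

/-- `(z^k)` and `(x^k)` are generated by the algorithm from the initial point `z0`. -/
structure IsGenerated (A : Fin (m + 1) → H → Set H) (B : Fin m → H → H) (t γ : ℝ)
    (z0 : Power H m) (z : ℕ → Power H m) (x : ℕ → Power H (m + 1)) : Prop where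
  init : z 0 = z0
  resolvent_step : ∀ k, IsResolventStep A B t (z k) (x k)
  update_step : ∀ k, z (k + 1) = update γ (z k) (x k)

end Algorithm

end DFB

/-! Clearing the resolvents turns (1) into inclusions `t⁻¹ • r j ∈ A j (x j)`, where the residual
`r` is linear in `z`, `x` and the forward values `b i = B i (x i)`. A zero `q` of the sum yields a
point `p` whose entries of `x` all equal `q`, hence a fixed point of `T`; such pairs are the
`IsFixedPair`s.

Monotonicity is summed over `j` between an iterate and a fixed pair. Summation by parts
(`sum_inner_self_residual`) leaves `z - p` paired with the consecutive differences of `x`, and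
negative squares. Cocoercivity and Young's inequality absorb the forward terms, which gives the
Fejér estimate `sum_norm_update_sub_sq_le`. The bound on `γ` makes its coefficients positive for a
suitable Young parameter, so `z` is bounded, consecutive differences of `x` vanish, and the forward
values converge strongly.

For weak cluster points, the same identity expresses `∑ ⟪x j, r j⟫` through products of a strongly
and a weakly convergent factor, so the sum passes to the limit although single terms need not.
Maximality then yields a fixed pair (`isFixedPair_of_weakTendsto`), and Opial's lemma gives
convergence of `z`. The first entry of `x` has a single cluster point because a resolvent is
single-valued; the other entries follow it. Solvability of (1) is Minty's theorem, obtained from the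
Debrunner–Flor lemma. -/

namespace DFB

open Filter

/-! ### Weak convergence, ultrafilter compactness and Opial's lemma. -/

section Weak

variable {E : Type*} [NormedAddCommGroup E] [InnerProductSpace ℝ E] {ι : Type*}

/-- Weak convergence along a filter, tested against inner products. -/
def WeakTendsto (f : ι → E) (F : Filter ι) (l : E) : Prop :=
  ∀ v : E, Tendsto (fun k => ⟪v, f k⟫) F (𝓝 ⟪v, l⟫)

theorem convergesWeakly_iff [CompleteSpace E] (f : ℕ → E) (l : E) :
    ConvergesWeakly f l ↔ WeakTendsto f atTop l := by
  unfold ConvergesWeakly WeakTendsto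
  have key : Topology.IsInducing (fun (x : WeakSpace ℝ E) (φ : StrongDual ℝ E) => topDualPairing ℝ E φ x) :=
    ⟨rfl⟩
  rw [key.tendsto_nhds_iff, tendsto_pi_nhds]
  constructor
  · intro h v
    exact h (InnerProductSpace.toDual ℝ E v)
  · intro h φ
    have := h ((InnerProductSpace.toDual ℝ E).symm φ)
    simp only [InnerProductSpace.toDual_symm_apply] at this
    exact this

theorem WeakTendsto.mono {f : ι → E} {F G : Filter ι} {l : E} (h : WeakTendsto f F l)
    (hG : G ≤ F) : WeakTendsto f G l :=
  fun v => (h v).mono_left hG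

theorem weakTendsto_iff_ultrafilter {f : ι → E} {F : Filter ι} {l : E} :
    WeakTendsto f F l ↔ ∀ U : Ultrafilter ι, ↑U ≤ F → WeakTendsto f U l := by
  refine ⟨fun h U hU => h.mono hU, fun h v => ?_⟩
  rw [tendsto_iff_ultrafilter]
  exact fun U hU => h U hU v

/-- A strongly convergent perturbation of a weakly convergent family. -/
theorem WeakTendsto.add_tendsto {f g : ι → E} {F : Filter ι} {l d : E} (h : WeakTendsto f F l)
    (hg : Tendsto g F (𝓝 d)) : WeakTendsto (fun k => f k + g k) F (l + d) := fun v => by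
  simp only [inner_add_right]
  exact (h v).add (tendsto_const_nhds.inner hg)

theorem WeakTendsto.eq {f : ι → E} {F : Filter ι} [F.NeBot] {l l' : E} (h : WeakTendsto f F l)
    (h' : WeakTendsto f F l') : l = l' :=
  ext_inner_left ℝ fun v => tendsto_nhds_unique (h v) (h' v)

/-- Pairing a bounded weakly convergent family with a strongly convergent one. -/
theorem WeakTendsto.inner_tendsto {f g : ι → E} {F : Filter ι} {l d : E} {R : ℝ}
    (h : WeakTendsto f F l) (hR : ∀ᶠ k in F, ‖f k‖ ≤ R) (hg : Tendsto g F (𝓝 d)) :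
    Tendsto (fun k => ⟪g k, f k⟫) F (𝓝 ⟪d, l⟫) := by
  have h1 : Tendsto (fun k => ⟪g k - d, f k⟫) F (𝓝 0) := by
    have h2 : Tendsto (fun k => ‖g k - d‖ * R) F (𝓝 0) := by
      simpa using (tendsto_iff_norm_sub_tendsto_zero.1 hg).mul_const R
    refine squeeze_zero_norm' ?_ h2
    filter_upwards [hR] with k hk
    exact (norm_inner_le_norm _ _).trans (mul_le_mul_of_nonneg_left hk (norm_nonneg _))
  have := h1.add (h d)
  simpa only [inner_sub_left, sub_add_cancel, zero_add] using this

/-- Weak compactness of balls in a Hilbert space, in terms of ultrafilters. -/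
theorem exists_weakTendsto_ultrafilter [CompleteSpace E] (U : Ultrafilter ι) (f : ι → E) {R : ℝ}
    (hR : ∀ k, ‖f k‖ ≤ R) : ∃ l, WeakTendsto f U l := by
  let g : ι → WeakDual ℝ E := fun k => StrongDual.toWeakDual (InnerProductSpace.toDual ℝ E (f k))
  have hK := WeakDual.isCompact_closedBall (𝕜 := ℝ) (0 : StrongDual ℝ E) R
  obtain ⟨φ, -, hφ⟩ := hK.ultrafilter_le_nhds' (U.map g) (by
    refine mem_map.2 (univ_mem' fun k => ?_)
    simp [g, hR k])
  have hφ' : Tendsto g U (𝓝 φ) := hφ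
  refine ⟨(InnerProductSpace.toDual ℝ E).symm (WeakDual.toStrongDual φ), fun v => ?_⟩
  have := (WeakDual.eval_continuous v).continuousAt.tendsto.comp hφ'
  rw [real_inner_comm, InnerProductSpace.toDual_symm_apply]
  refine Tendsto.congr (fun k => ?_) this
  exact real_inner_comm v (f k)

/-- Opial's lemma. -/
theorem exists_weakTendsto_of_tendsto_norm_sub [CompleteSpace E] (f : ℕ → E) (S : Set E) {R : ℝ}
    (hR : ∀ k, ‖f k‖ ≤ R)
    (hS : ∀ p ∈ S, ∃ c, Tendsto (fun k => ‖f k - p‖ ^ 2) atTop (𝓝 c))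
    (hU : ∀ (U : Ultrafilter ℕ) (l : E), ↑U ≤ (atTop : Filter ℕ) → WeakTendsto f U l → l ∈ S) :
    ∃ l ∈ S, WeakTendsto f atTop l := by
  have hV : ↑(Ultrafilter.of (atTop : Filter ℕ)) ≤ (atTop : Filter ℕ) := Ultrafilter.of_le _
  obtain ⟨q, hq⟩ := exists_weakTendsto_ultrafilter (Ultrafilter.of (atTop : Filter ℕ)) f hR
  have hqS := hU _ q hV hq
  refine ⟨q, hqS, weakTendsto_iff_ultrafilter.2 fun U hUle => ?_⟩
  obtain ⟨p, hp⟩ := exists_weakTendsto_ultrafilter U f hR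
  have hpS := hU _ p hUle hp
  suffices p = q by rwa [← this]
  obtain ⟨c, hc⟩ := hS p hpS
  obtain ⟨d, hd⟩ := hS q hqS
  -- Expanding the squares, `‖f k‖ ^ 2` cancels in the difference of the two convergent distances,
  -- so this pairing has one limit along the whole sequence.
  have key : Tendsto (fun k => ⟪p - q, f k⟫) atTop
      (𝓝 ((d - c + (‖p‖ ^ 2 - ‖q‖ ^ 2)) / 2)) := by
    refine (((hd.sub hc).add_const _).div_const 2).congr fun k => ?_
    rw [norm_sub_sq_real, norm_sub_sq_real, inner_sub_left, real_inner_comm p, real_inner_comm q]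
    ring
  have h1 := tendsto_nhds_unique (hp (p - q)) (key.mono_left hUle)
  have h2 := tendsto_nhds_unique (hq (p - q)) (key.mono_left hV)
  have h3 : ⟪p - q, p - q⟫ = 0 := by rw [inner_sub_right, h1, h2, sub_self]
  exact sub_eq_zero.1 (inner_self_eq_zero.1 h3)

end Weak

/-! ### Debrunner–Flor, Minty's theorem and resolvents. -/

section Minty

variable {H : Type*} [NormedAddCommGroup H] [InnerProductSpace ℝ H]

/-- The Debrunner–Flor lemma for a finite monotone family. -/
theorem exists_forall_inner_le_zero_of_fintype {ι : Type*} [Fintype ι] [Nonempty ι]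
    (y v : ι → H) (h : ∀ i j, 0 ≤ ⟪y i - y j, v i - v j⟫) :
    ∃ x : H, ∀ i, ⟪x - y i, x + v i⟫ ≤ 0 := by
  classical
  -- Lagrangian duality: `∑ w i * ⟪x - y i, x + v i⟫ = ‖x‖ ^ 2 - 2 * ⟪x, X w⟫ - c w` on the simplex,
  -- minimal at `x = X w` with value `g w`. A maximiser of the dual function `g` supplies the
  -- solution.
  let X : (ι → ℝ) → H := fun w => ∑ i, w i • ((1 / 2 : ℝ) • (y i - v i))
  let c : (ι → ℝ) → ℝ := fun w => ∑ i, w i * ⟪y i, v i⟫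
  let g : (ι → ℝ) → ℝ := fun w => -‖X w‖ ^ 2 - c w
  have hXc : Continuous X := by fun_prop
  have hcc : Continuous c := by fun_prop
  have hg : Continuous g := by fun_prop
  have hne : (stdSimplex ℝ ι).Nonempty := ⟨_, single_mem_stdSimplex ℝ (Classical.arbitrary ι)⟩
  obtain ⟨w, hw, hmax⟩ := (isCompact_stdSimplex ℝ ι).exists_isMaxOn hne hg.continuousOn
  have hg0 : g w ≤ 0 := by
    set Y := ∑ i, w i • y i
    set V := ∑ i, w i • v i
    have hX : X w = (1 / 2 : ℝ) • (Y - V) := by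
      simp only [X, Y, V, smul_sub, Finset.sum_sub_distrib, Finset.smul_sum]
      simp only [smul_comm (1 / 2 : ℝ)]
    have hsum : 0 ≤ ∑ i, ∑ j, w i * w j * ⟪y i - y j, v i - v j⟫ :=
      Finset.sum_nonneg fun i _ => Finset.sum_nonneg fun j _ =>
        mul_nonneg (mul_nonneg (hw.1 i) (hw.1 j)) (h i j)
    have hexp : ∑ i, ∑ j, w i * w j * ⟪y i - y j, v i - v j⟫ = 2 * c w - 2 * ⟪Y, V⟫ := by
      have e1 : ∑ i, ∑ j, w i * w j * ⟪y i, v i⟫ = c w := by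
        refine Finset.sum_congr rfl fun i _ => ?_
        rw [← Finset.sum_mul, ← Finset.mul_sum, hw.2, mul_one]
      have e2 : ∑ i, ∑ j, w i * w j * ⟪y j, v j⟫ = c w := by
        rw [Finset.sum_comm, ← e1]
        refine Finset.sum_congr rfl fun i _ => Finset.sum_congr rfl fun j _ => ?_
        rw [mul_comm (w j)]
      have e3 : ∑ i, ∑ j, w i * w j * ⟪y i, v j⟫ = ⟪Y, V⟫ := by
        simp only [Y, V, sum_inner, inner_sum, real_inner_smul_left, real_inner_smul_right,
          mul_assoc]
        rw [Finset.sum_comm]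
        refine Finset.sum_congr rfl fun i _ => Finset.sum_congr rfl fun j _ => ?_
        rw [mul_left_comm]
      have e4 : ∑ i, ∑ j, w i * w j * ⟪y j, v i⟫ = ⟪Y, V⟫ := by
        rw [Finset.sum_comm, ← e3]
        refine Finset.sum_congr rfl fun i _ => Finset.sum_congr rfl fun j _ => ?_
        rw [mul_comm (w j)]
      calc _ = ∑ i, ∑ j, (w i * w j * ⟪y i, v i⟫ + w i * w j * ⟪y j, v j⟫
            - w i * w j * ⟪y i, v j⟫ - w i * w j * ⟪y j, v i⟫) := by
            refine Finset.sum_congr rfl fun i _ => Finset.sum_congr rfl fun j _ => ?_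
            simp only [inner_sub_left, inner_sub_right]
            ring
        _ = _ := by
            simp only [Finset.sum_sub_distrib, Finset.sum_add_distrib, e1, e2, e3, e4]
            ring
    have hs : ‖Y + V‖ ^ 2 = ‖Y - V‖ ^ 2 + 4 * ⟪Y, V⟫ := by
      rw [norm_add_sq_real, norm_sub_sq_real]; ring
    have : g w = -(1 / 4) * ‖Y - V‖ ^ 2 - c w := by
      simp only [g, hX, norm_smul, mul_pow]
      norm_num
    nlinarith [sq_nonneg ‖Y + V‖]
  refine ⟨X w, fun i => ?_⟩
  set e : ι → ℝ := Pi.single i 1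
  have he : e ∈ stdSimplex ℝ ι := single_mem_stdSimplex ℝ i
  have hXe : X e = (1 / 2 : ℝ) • (y i - v i) := by
    simp [X, e]
  have hce : c e = ⟪y i, v i⟫ := by simp [c, e, Pi.single_apply, ite_mul]
  -- First-order optimality of `w` towards the vertex `e`.
  have hder : -2 * ⟪X w, X e - X w⟫ - (c e - c w) ≤ 0 := by
    by_contra! hpos
    set a := -2 * ⟪X w, X e - X w⟫ - (c e - c w)
    set q := ‖X e - X w‖ ^ 2
    have hq : 0 ≤ q := sq_nonneg _
    have hs : ∀ s : ℝ, 0 ≤ s → s ≤ 1 → s * a - s ^ 2 * q ≤ 0 := by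
      intro s h0 h1
      have hmem : (1 - s) • w + s • e ∈ stdSimplex ℝ ι :=
        convex_stdSimplex ℝ ι hw he (by linarith) h0 (by ring)
      have h2 : g ((1 - s) • w + s • e) ≤ g w := hmax hmem
      have h3 : X ((1 - s) • w + s • e) = X w + s • (X e - X w) := by
        have : X ((1 - s) • w + s • e) = (1 - s) • X w + s • X e := by
          simp only [X, Pi.add_apply, Pi.smul_apply, add_smul, Finset.sum_add_distrib,
            Finset.smul_sum, smul_assoc]
        rw [this]; module
      have h4 : c ((1 - s) • w + s • e) = c w + s * (c e - c w) := by
        have : c ((1 - s) • w + s • e) = (1 - s) * c w + s * c e := by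
          simp only [c, Pi.add_apply, Pi.smul_apply, add_mul, Finset.sum_add_distrib,
            Finset.mul_sum, smul_eq_mul, mul_assoc]
        rw [this]; ring
      simp only [g, h3, h4, norm_add_sq_real, norm_smul, mul_pow, real_inner_smul_right,
        Real.norm_eq_abs, sq_abs] at h2
      simp only [a, q]
      linarith
    have hd : 0 < a + q + 1 := by linarith
    -- This step length lies in `[0, 1]` and makes `s * a - s ^ 2 * q` positive.
    have h5 := hs (a / (a + q + 1)) (by positivity) (by rw [div_le_one hd]; linarith)
    have h6 : a / (a + q + 1) * a - (a / (a + q + 1)) ^ 2 * q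
        = a ^ 2 * (a + 1) / (a + q + 1) ^ 2 := by
      field_simp
      ring
    rw [h6] at h5
    have : 0 < a ^ 2 * (a + 1) / (a + q + 1) ^ 2 := by positivity
    linarith
  have hfin : ⟪X w - y i, X w + v i⟫ = g w + (-2 * ⟪X w, X e - X w⟫ - (c e - c w)) := by
    simp only [g, hXe, hce, inner_sub_left, inner_sub_right, inner_add_right,
      real_inner_smul_right, real_inner_self_eq_norm_sq, real_inner_comm (X w) (y i)]
    ring
  rw [hfin]
  linarith

/-- The Debrunner–Flor lemma. -/
theorem exists_forall_inner_le_zero [CompleteSpace H] (S : Set (H × H))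
    (hS : ∀ p ∈ S, ∀ q ∈ S, 0 ≤ ⟪p.1 - q.1, p.2 - q.2⟫) :
    ∃ x : H, ∀ p ∈ S, ⟪x - p.1, x + p.2⟫ ≤ 0 := by
  classical
  rcases S.eq_empty_or_nonempty with rfl | ⟨p₀, hp₀⟩
  · exact ⟨0, by simp⟩
  -- Every finite subset is enlarged by `p₀`, whose inequality alone bounds all the solutions
  -- uniformly.
  have hfin : ∀ F : Finset S, ∃ x : H, ∀ p ∈ insert ⟨p₀, hp₀⟩ F,
      ⟪x - (p : H × H).1, x + (p : H × H).2⟫ ≤ 0 := by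
    intro F
    have : Nonempty (insert ⟨p₀, hp₀⟩ F : Finset S) :=
      ⟨⟨⟨p₀, hp₀⟩, Finset.mem_insert_self _ _⟩⟩
    obtain ⟨x, hx⟩ := exists_forall_inner_le_zero_of_fintype
      (fun p : (insert ⟨p₀, hp₀⟩ F : Finset S) => (p : H × H).1) (fun p => (p : H × H).2)
      (fun i j => hS _ i.1.2 _ j.1.2)
    exact ⟨x, fun p hp => hx ⟨p, hp⟩⟩
  choose f hf using hfin
  have hR : ∀ F, ‖f F‖ ≤ 2 * (‖p₀.1‖ + ‖p₀.2‖) := by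
    intro F
    have h1 := hf F _ (Finset.mem_insert_self _ _)
    simp only [inner_sub_left, inner_add_right, real_inner_self_eq_norm_sq] at h1
    have h2 := abs_le.1 (abs_real_inner_le_norm (f F) p₀.2)
    have h3 := abs_le.1 (abs_real_inner_le_norm p₀.1 (f F))
    have h4 := abs_le.1 (abs_real_inner_le_norm p₀.1 p₀.2)
    by_contra! hlt
    nlinarith [norm_nonneg (f F), norm_nonneg p₀.1, norm_nonneg p₀.2]
  let U := Ultrafilter.of (atTop : Filter (Finset S))
  obtain ⟨x, hx⟩ := exists_weakTendsto_ultrafilter U f hR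
  refine ⟨x, fun p hp => ?_⟩
  -- The term `‖f F‖ ^ 2` is not weakly continuous; its affine minorant `2 * ⟪x, f F⟫ - ‖x‖ ^ 2` is,
  -- and is exact at the limit `x`.
  have hev : ∀ᶠ F in (U : Filter (Finset S)),
      2 * ⟪x, f F⟫ - ‖x‖ ^ 2 + ⟪p.2, f F⟫ - ⟪p.1, f F⟫ - ⟪p.1, p.2⟫ ≤ 0 := by
    refine Ultrafilter.of_le _ ?_
    filter_upwards [eventually_ge_atTop {⟨p, hp⟩}] with F hF
    have h1 := hf F ⟨p, hp⟩ (Finset.mem_insert_of_mem (hF (Finset.mem_singleton_self _)))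
    have h2 := norm_sub_sq_real x (f F)
    simp only [inner_sub_left, inner_add_right, real_inner_self_eq_norm_sq] at h1
    rw [real_inner_comm (f F) p.2]
    nlinarith [sq_nonneg ‖x - f F‖]
  have hlim := ((((hx x).const_mul 2).sub_const (‖x‖ ^ 2)).add (hx p.2)).sub (hx p.1)
    |>.sub_const ⟪p.1, p.2⟫
  have := le_of_tendsto hlim hev
  simp only [inner_sub_left, inner_add_right, real_inner_self_eq_norm_sq] at this ⊢
  rw [real_inner_comm x p.2] at this
  linarith

/-- Otherwise adjoining `(x, u)` to the graph would give a proper monotone extension. -/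
theorem IsMaximallyMonotone.mem {A : H → Set H} (hA : IsMaximallyMonotone A) {x u : H}
    (h : ∀ y v, v ∈ A y → 0 ≤ ⟪x - y, u - v⟫) : u ∈ A x := by
  by_contra hu
  refine hA.2 ⟨fun y => {v | v ∈ A y ∨ (y = x ∧ v = u)}, ?_, ?_⟩
  · rintro y y' v v' (hv | ⟨rfl, rfl⟩) (hv' | ⟨rfl, rfl⟩)
    · exact hA.1 y y' v v' hv hv'
    · have := h y v hv
      rw [← neg_sub, ← neg_sub v, inner_neg_neg] at this
      exact this
    · exact h y' v' hv'
    · simp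
  · refine ⟨fun p hp => Or.inl hp, fun hsub => hu ?_⟩
    exact hsub (show (x, u) ∈ graph _ from Or.inr ⟨rfl, rfl⟩)

theorem mem_resolventOp_iff {A : H → Set H} {t : ℝ} (ht : 0 < t) {w x : H} :
    x ∈ resolventOp t A w ↔ t⁻¹ • (w - x) ∈ A x := by
  change w ∈ ({x} : Set H) + t • A x ↔ _
  rw [Set.singleton_add, Set.image_add_left, Set.mem_preimage,
    Set.mem_smul_set_iff_inv_smul_mem₀ ht.ne', neg_add_eq_sub]

/-- Minty's theorem. -/
theorem IsMaximallyMonotone.exists_mem_resolventOp [CompleteSpace H] {A : H → Set H}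
    (hA : IsMaximallyMonotone A) {t : ℝ} (ht : 0 < t) (w : H) : ∃ x, x ∈ resolventOp t A w := by
  obtain ⟨x, hx⟩ := exists_forall_inner_le_zero
    ((fun p : H × H => (p.1, t • p.2 - w)) '' graph A) (by
      rintro _ ⟨p, hp, rfl⟩ _ ⟨q, hq, rfl⟩
      have := hA.1 p.1 q.1 p.2 q.2 hp hq
      simp only [sub_sub_sub_cancel_right, ← smul_sub, real_inner_smul_right]
      positivity)
  refine ⟨x, (mem_resolventOp_iff ht).2 (hA.mem fun y v hv => ?_)⟩
  have h1 := hx _ ⟨(y, v), hv, rfl⟩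
  have h2 : t⁻¹ • (w - x) - v = (-t⁻¹) • (x + (t • v - w)) := by
    have : t⁻¹ • t • v = v := inv_smul_smul₀ ht.ne' v
    rw [smul_add, smul_sub, neg_smul, neg_smul, smul_sub t⁻¹ (t • v), this]
    abel
  rw [h2, real_inner_smul_right]
  have := inv_pos.2 ht
  nlinarith

/-- The resolvent of a monotone operator is firmly nonexpansive. -/
theorem IsMonotone.resolventOp_norm_sub_sq_le {A : H → Set H} (hA : IsMonotone A) {t : ℝ}
    (ht : 0 < t) {w w' x x' : H} (hx : x ∈ resolventOp t A w) (hx' : x' ∈ resolventOp t A w') :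
    ‖x - x'‖ ^ 2 ≤ ⟪x - x', w - w'⟫ := by
  rw [mem_resolventOp_iff ht] at hx hx'
  have h := hA x x' _ _ hx hx'
  rw [← smul_sub, real_inner_smul_right] at h
  have h2 := nonneg_of_mul_nonneg_right h (inv_pos.2 ht)
  rw [sub_sub_sub_comm, inner_sub_right, real_inner_self_eq_norm_sq] at h2
  linarith

theorem IsMonotone.resolventOp_norm_sub_le {A : H → Set H} (hA : IsMonotone A) {t : ℝ}
    (ht : 0 < t) {w w' x x' : H} (hx : x ∈ resolventOp t A w) (hx' : x' ∈ resolventOp t A w') :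
    ‖x - x'‖ ≤ ‖w - w'‖ := by
  have h := hA.resolventOp_norm_sub_sq_le ht hx hx'
  have h2 := real_inner_le_norm (x - x') (w - w')
  by_contra! hlt
  nlinarith [norm_nonneg (w - w'), norm_nonneg (x - x')]

theorem IsMonotone.resolventOp_unique {A : H → Set H} (hA : IsMonotone A) {t : ℝ}
    (ht : 0 < t) {w x x' : H} (hx : x ∈ resolventOp t A w) (hx' : x' ∈ resolventOp t A w) :
    x = x' := by
  have h := hA.resolventOp_norm_sub_le ht hx hx'
  rw [sub_self, norm_zero] at h
  exact sub_eq_zero.1 (norm_le_zero_iff.1 h)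

end Minty

variable {H : Type*} [NormedAddCommGroup H] [InnerProductSpace ℝ H] {m : ℕ}

/-! ### The algorithm as a system of inclusions. -/

section Residual

/-- With `b i = B i (x i)`, the `j`-th entry is the element of `t • A j (x j)` prescribed by the
algorithm. -/
def residual (t : ℝ) (z b : Fin m → H) (x : Fin (m + 1) → H) (j : Fin (m + 1)) : H :=
  Fin.snoc (α := fun _ => H) z (x 0) j -
    Fin.cons (α := fun _ => H) 0 (fun i => z i - x i.castSucc + t • b i) j - x j

theorem residual_zero (t : ℝ) (z b : Fin (m + 1) → H) (x : Fin (m + 2) → H) :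
    residual t z b x (Fin.castSucc 0) = z 0 - x (Fin.castSucc 0) := by
  unfold residual
  rw [Fin.snoc_castSucc, Fin.castSucc_zero, Fin.cons_zero, sub_zero]

theorem residual_castSucc_succ (t : ℝ) (z b : Fin (m + 1) → H) (x : Fin (m + 2) → H) (i : Fin m) :
    residual t z b x i.succ.castSucc = z i.succ + x i.castSucc.castSucc - z i.castSucc
      - t • b i.castSucc - x i.succ.castSucc := by
  unfold residual
  rw [Fin.snoc_castSucc, ← Fin.succ_castSucc, Fin.cons_succ]
  abel

theorem residual_last (t : ℝ) (z b : Fin (m + 1) → H) (x : Fin (m + 2) → H) :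
    residual t z b x (Fin.last (m + 1)) = x 0 + x (Fin.last m).castSucc - z (Fin.last m)
      - t • b (Fin.last m) - x (Fin.last (m + 1)) := by
  unfold residual
  rw [Fin.snoc_last, ← Fin.succ_last, Fin.cons_succ]
  abel

theorem residual_sub (t : ℝ) (z z' b b' : Fin m → H) (x x' : Fin (m + 1) → H) (j : Fin (m + 1)) :
    residual t z b x j - residual t z' b' x' j = residual t (z - z') (b - b') (x - x') j := by
  unfold residual
  have h1 : Fin.snoc (α := fun _ => H) (z - z') ((x - x') 0) j
      = Fin.snoc (α := fun _ => H) z (x 0) j - Fin.snoc (α := fun _ => H) z' (x' 0) j := by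
    refine Fin.lastCases ?_ (fun i => ?_) j <;> simp
  have h2 : Fin.cons (α := fun _ => H) 0
        (fun i => (z - z') i - (x - x') i.castSucc + t • (b - b') i) j
      = Fin.cons (α := fun _ => H) 0 (fun i => z i - x i.castSucc + t • b i) j
        - Fin.cons (α := fun _ => H) 0 (fun i => z' i - x' i.castSucc + t • b' i) j := by
    refine Fin.cases ?_ (fun i => ?_) j
    · simp
    · simp only [Fin.cons_succ, Pi.sub_apply, smul_sub]
      abel
  rw [h1, h2, Pi.sub_apply]
  abel

/-- Summation by parts: `z i` enters entry `i` with sign `+` and entry `i + 1` with sign `-`, so it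
meets only differences of `y`. -/
theorem sum_inner_residual (t : ℝ) (z b : Fin m → H) (x y : Fin (m + 1) → H) :
    ∑ j, ⟪y j, residual t z b x j⟫ = -∑ i : Fin m, ⟪y i.succ - y i.castSucc, z i⟫
      + ⟪y (Fin.last m), x 0⟫ + ∑ i : Fin m, ⟪y i.succ, x i.castSucc⟫
      - t * ∑ i : Fin m, ⟪y i.succ, b i⟫ - ∑ j, ⟪y j, x j⟫ := by
  simp only [residual, inner_sub_right, Finset.sum_sub_distrib]
  rw [Fin.sum_univ_castSucc (f := fun j => ⟪y j, Fin.snoc (α := fun _ => H) z (x 0) j⟫),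
    Fin.sum_univ_succ (f := fun j => ⟪y j,
      Fin.cons (α := fun _ => H) 0 (fun i => z i - x i.castSucc + t • b i) j⟫)]
  simp only [Fin.snoc_castSucc, Fin.snoc_last, Fin.cons_zero, Fin.cons_succ, inner_zero_right,
    inner_add_right, inner_sub_right, inner_sub_left, real_inner_smul_right,
    Finset.sum_add_distrib, Finset.sum_sub_distrib, Finset.mul_sum]
  ring

/-- The products of neighbouring entries, closed up by the `x 0` in the last step, form a cycle;
polarisation turns them minus the squared norms into minus half the squared differences. -/
theorem sum_inner_self_residual (t : ℝ) (z b : Fin m → H) (x : Fin (m + 1) → H) :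
    ∑ j, ⟪x j, residual t z b x j⟫ = -∑ i : Fin m, ⟪x i.succ - x i.castSucc, z i⟫
      - (1 / 2) * ‖x (Fin.last m) - x 0‖ ^ 2
      - (1 / 2) * ∑ i : Fin m, ‖x i.succ - x i.castSucc‖ ^ 2
      - t * ∑ i : Fin m, ⟪x i.succ, b i⟫ := by
  rw [sum_inner_residual]
  have h1 := Fin.sum_univ_castSucc (f := fun j => ‖x j‖ ^ 2)
  have h2 := Fin.sum_univ_succ (f := fun j => ‖x j‖ ^ 2)
  simp only [real_inner_self_eq_norm_sq, norm_sub_sq_real, Finset.sum_add_distrib,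
    Finset.sum_sub_distrib, ← Finset.mul_sum]
  linarith

theorem sum_residual (t : ℝ) (z b : Fin m → H) (x : Fin (m + 1) → H) :
    ∑ j, residual t z b x j = x 0 - x (Fin.last m) - t • ∑ i, b i := by
  refine ext_inner_left ℝ fun v => ?_
  have h := sum_inner_residual t z b x (fun _ => v)
  rw [inner_sum, h, Fin.sum_univ_castSucc (f := fun j => ⟪v, x j⟫)]
  simp only [sub_self, inner_zero_left, Finset.sum_const_zero, inner_sub_right,
    real_inner_smul_right, inner_sum]
  ring

theorem isResolventStep_iff (hm : 1 ≤ m) {A : Fin (m + 1) → H → Set H} {B : Fin m → H → H} {t : ℝ}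
    (ht : 0 < t) {z : Power H m} {x : Power H (m + 1)} :
    IsResolventStep A B t z x ↔
      ∀ j, t⁻¹ • residual t (fun i => z i) (fun i => B i (x i.castSucc)) (fun j => x j) j
        ∈ A j (x j) := by
  obtain ⟨m, rfl⟩ : ∃ k, m = k + 1 := ⟨m - 1, by omega⟩
  constructor
  · intro h
    refine Fin.lastCases ?_ (Fin.cases ?_ fun i => ?_)
    · rw [residual_last]
      exact (mem_resolventOp_iff ht).1 (h.last (Fin.last m) (by simp))
    · rw [residual_zero]
      exact (mem_resolventOp_iff ht).1 (h.first 0 rfl)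
    · rw [residual_castSucc_succ]
      exact (mem_resolventOp_iff ht).1 (h.middle i.castSucc i.succ (by simp))
  · intro h
    refine ⟨fun i hi => ?_, fun i j hij => ?_, fun i hi => ?_⟩
    · obtain rfl : i = 0 := Fin.ext hi
      have := h (Fin.castSucc 0)
      rw [residual_zero] at this
      exact (mem_resolventOp_iff ht).2 this
    · obtain ⟨k, rfl⟩ : ∃ k : Fin m, i = k.castSucc := ⟨⟨i, by omega⟩, rfl⟩
      obtain rfl : j = k.succ := Fin.ext (by simpa using hij)
      have := h k.succ.castSucc
      rw [residual_castSucc_succ] at this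
      exact (mem_resolventOp_iff ht).2 this
    · obtain rfl : i = Fin.last m := Fin.ext (by simpa using hi)
      have := h (Fin.last (m + 1))
      rw [residual_last] at this
      exact (mem_resolventOp_iff ht).2 this

theorem IsResolventStep.unique {A : Fin (m + 1) → H → Set H} (hA : ∀ j, IsMonotone (A j))
    (hm : 1 ≤ m) {B : Fin m → H → H} {t : ℝ} (ht : 0 < t) {z : Power H m}
    {x x' : Power H (m + 1)} (h : IsResolventStep A B t z x) (h' : IsResolventStep A B t z x') :
    x = x' := by
  obtain ⟨m, rfl⟩ : ∃ k, m = k + 1 := ⟨m - 1, by omega⟩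
  have key : ∀ i : Fin (m + 1), x i.castSucc = x' i.castSucc := by
    intro i
    induction i using Fin.induction with
    | zero => exact (hA _).resolventOp_unique ht (h.first 0 rfl) (h'.first 0 rfl)
    | succ i ih =>
      have h1 := h.middle i.castSucc i.succ (by simp)
      rw [ih] at h1
      exact (hA _).resolventOp_unique ht h1 (h'.middle i.castSucc i.succ (by simp))
  ext j
  refine Fin.lastCases ?_ key j
  have h1 := h.last (Fin.last m) (by simp)
  have h0 := key 0
  rw [Fin.castSucc_zero] at h0
  rw [key, h0] at h1
  exact (hA _).resolventOp_unique ht h1 (h'.last (Fin.last m) (by simp))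

theorem exists_isResolventStep [CompleteSpace H] {A : Fin (m + 1) → H → Set H}
    (hA : ∀ j, IsMaximallyMonotone (A j)) (hm : 1 ≤ m) (B : Fin m → H → H) {t : ℝ} (ht : 0 < t)
    (z : Power H m) : ∃ x, IsResolventStep A B t z x := by
  obtain ⟨m, rfl⟩ : ∃ k, m = k + 1 := ⟨m - 1, by omega⟩
  choose J hJ using fun j w => (hA j).exists_mem_resolventOp ht w
  let y : Fin (m + 1) → H := fun i => Fin.induction (motive := fun _ => H)
    (J (Fin.castSucc 0) (z 0)) (fun i w => J i.succ.castSucc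
      (z i.succ + w - z i.castSucc - t • B i.castSucc w)) i
  let x : Fin (m + 2) → H := Fin.snoc (α := fun _ => H) y (J (Fin.last (m + 1))
    (y 0 + y (Fin.last m) - z (Fin.last m) - t • B (Fin.last m) (y (Fin.last m))))
  have hx : ∀ i : Fin (m + 1), x i.castSucc = y i := fun i => by simp [x]
  have hx0 : x 0 = y 0 := hx 0
  have hxl : x (Fin.last (m + 1)) = J (Fin.last (m + 1))
    (y 0 + y (Fin.last m) - z (Fin.last m) - t • B (Fin.last m) (y (Fin.last m))) := by simp [x]
  refine ⟨WithLp.toLp 2 x, fun i hi => ?_, fun i j hij => ?_, fun i hi => ?_⟩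
  · obtain rfl : i = 0 := Fin.ext hi
    change x (Fin.castSucc 0) ∈ resolventOp t (A (Fin.castSucc 0)) (z 0)
    rw [hx]
    exact hJ _ _
  · obtain ⟨k, rfl⟩ : ∃ k : Fin m, i = k.castSucc := ⟨⟨i, by omega⟩, rfl⟩
    obtain rfl : j = k.succ := Fin.ext (by simpa using hij)
    change x _ ∈ resolventOp t _ (_ + x _ - _ - t • B _ (x _))
    rw [hx, hx]
    exact hJ _ _
  · obtain rfl : i = Fin.last m := Fin.ext (by simpa using hi)
    change x _ ∈ resolventOp t _ (x 0 + x _ - _ - t • B _ (x _))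
    rw [hx, hx0, hxl]
    exact hJ _ _

theorem existsUnique_isGenerated [CompleteSpace H] {A : Fin (m + 1) → H → Set H}
    (hA : ∀ j, IsMaximallyMonotone (A j)) (hm : 1 ≤ m) (B : Fin m → H → H) {t : ℝ} (ht : 0 < t)
    (γ : ℝ) (z0 : Power H m) :
    ∃! s : (ℕ → Power H m) × (ℕ → Power H (m + 1)), IsGenerated A B t γ z0 s.1 s.2 := by
  choose X hX using exists_isResolventStep hA hm B ht
  let z : ℕ → Power H m := fun k => Nat.rec z0 (fun _ w => update γ w (X w)) k
  refine ⟨(z, fun k => X (z k)), ⟨rfl, fun k => hX _, fun k => rfl⟩, ?_⟩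
  rintro ⟨z', x'⟩ h
  have hx : ∀ k, x' k = X (z' k) := fun k =>
    (h.resolvent_step k).unique (fun j => (hA j).1) hm ht (hX _)
  have hz : z' = z := by
    funext k
    induction k with
    | zero => exact h.init
    | succ k ih =>
      have h1 := h.update_step k
      simp only at h1 ih
      rw [h1, hx k, ih]
  refine Prod.ext hz (funext fun k => ?_)
  simp only [hx, hz]

end Residual

/-! ### Zeros of the sum and fixed points of `T`. -/

section FixedPair

/-- The point `q` is generated in all entries from the point `p`, which is then a fixed point. -/
def IsFixedPair (A : Fin (m + 1) → H → Set H) (B : Fin m → H → H) (t : ℝ) (p : Fin m → H)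
    (q : H) : Prop :=
  ∀ j, t⁻¹ • residual t p (fun i => B i q) (fun _ => q) j ∈ A j q

theorem IsFixedPair.mem_fix {A : Fin (m + 1) → H → Set H} {B : Fin m → H → H} {t : ℝ}
    {p : Power H m} {q : H} (h : IsFixedPair A B t (fun i => p i) q) (hm : 1 ≤ m) (ht : 0 < t)
    (γ : ℝ) : p ∈ fix (T A B t γ) := by
  refine ⟨WithLp.toLp 2 fun _ => q, (isResolventStep_iff hm ht).2 h, ?_⟩
  ext i
  simp [update]

theorem mem_zer_sumOperator_iff {E : Type*} [NormedAddCommGroup E]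
    {A : Fin (m + 1) → E → Set E} {B : Fin m → E → E} {q : E} :
    q ∈ zer (sumOperator A B) ↔
      ∃ u : Fin (m + 1) → E, (∀ j, u j ∈ A j q) ∧ ∑ j, u j + ∑ i, B i q = 0 := by
  have hB : (∑ i, ofMap (B i)) q = {∑ i, B i q} := by
    rw [Finset.sum_apply]
    exact (map_sum (Set.singletonAddMonoidHom (α := E)) (fun i => B i q) Finset.univ).symm
  change (0 : E) ∈ (∑ j, A j) q + (∑ i, ofMap (B i)) q ↔ _
  rw [hB, Finset.sum_apply, Set.mem_add]
  constructor
  · rintro ⟨a, ha, b, rfl, hab⟩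
    obtain ⟨u, hu, rfl⟩ := (Set.mem_fintype_sum _ _).1 ha
    exact ⟨u, hu, hab⟩
  · rintro ⟨u, hu, h⟩
    exact ⟨_, (Set.mem_fintype_sum _ _).2 ⟨u, hu, rfl⟩, _, rfl, h⟩

theorem IsFixedPair.mem_zer {A : Fin (m + 1) → H → Set H} {B : Fin m → H → H} {t : ℝ}
    {p : Fin m → H} {q : H} (h : IsFixedPair A B t p q) (ht : 0 < t) :
    q ∈ zer (sumOperator A B) := by
  refine mem_zer_sumOperator_iff.2 ⟨_, h, ?_⟩
  rw [← Finset.smul_sum, sum_residual, sub_self, zero_sub, smul_neg, inv_smul_smul₀ ht.ne',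
    neg_add_cancel]

theorem exists_isFixedPair {A : Fin (m + 1) → H → Set H} {B : Fin m → H → H} {q : H}
    (hq : q ∈ zer (sumOperator A B)) (hm : 1 ≤ m) {t : ℝ} (ht : 0 < t) :
    ∃ p, IsFixedPair A B t p q := by
  obtain ⟨m, rfl⟩ : ∃ k, m = k + 1 := ⟨m - 1, by omega⟩
  obtain ⟨u, hu, h0⟩ := mem_zer_sumOperator_iff.1 hq
  let u' : ℕ → H := fun k => if h : k < m + 2 then u ⟨k, h⟩ else 0
  let b' : ℕ → H := fun k => if h : k < m + 1 then B ⟨k, h⟩ q else 0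
  have hu' : ∀ j : Fin (m + 2), u' j = u j := fun j => dif_pos j.2
  have hb' : ∀ i : Fin (m + 1), b' i = B i q := fun i => dif_pos i.2
  -- Partial sums with one more `u'` than `b'`; consecutive ones differ by what the residual
  -- prescribes, and `c (m + 1) = 0` is exactly the zero condition.
  let c : ℕ → H := fun k => ∑ l ∈ Finset.range (k + 1), u' l + ∑ l ∈ Finset.range k, b' l
  have hc : ∀ k, c (k + 1) = c k + u' (k + 1) + b' k := fun k => by
    simp only [c]
    rw [Finset.sum_range_succ u' (k + 1), Finset.sum_range_succ b' k]
    abel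
  have hc0 : c (m + 1) = 0 := by
    simp only [c, ← Fin.sum_univ_eq_sum_range, hu', hb']
    exact h0
  refine ⟨fun i => q + t • c i, fun j => ?_⟩
  suffices residual t (fun i => q + t • c i) (fun i => B i q) (fun _ => q) j = t • u j by
    rw [this, inv_smul_smul₀ ht.ne']
    exact hu j
  revert j
  refine Fin.lastCases ?_ (Fin.cases ?_ fun i => ?_)
  · rw [residual_last, ← hu', ← hb']
    have := hc m
    rw [hc0] at this
    have h1 : t • u' (m + 1) = -(t • c m) - t • b' m := by
      rw [← smul_neg, ← smul_sub]
      congr 1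
      rw [eq_sub_iff_add_eq, eq_neg_iff_add_eq_zero, this]
      abel
    simp only [Fin.val_last]
    rw [h1]
    abel
  · rw [residual_zero, ← hu']
    simp [c]
  · rw [residual_castSucc_succ, ← hu', ← hb']
    simp only [Fin.val_succ, Fin.val_castSucc, hc, smul_add]
    abel

end FixedPair

/-! ### The Fejér estimate and its summability consequences. -/

section Fejer

/-- Fejér monotonicity of the iteration, with the residual terms of the steps and of the
cocoercive operators. -/
theorem sum_norm_update_sub_sq_le {A : Fin (m + 1) → H → Set H} (hA : ∀ j, IsMonotone (A j))
    {B : Fin m → H → H} {L t γ ε : ℝ} (hB : ∀ i, IsCocoercive (1 / L) (B i)) (ht : 0 < t)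
    (hγ : 0 < γ) (hε : 0 < ε) {z p : Fin m → H} {x : Fin (m + 1) → H} {q : H}
    (hx : ∀ j, t⁻¹ • residual t z (fun i => B i (x i.castSucc)) x j ∈ A j (x j))
    (hp : IsFixedPair A B t p q) :
    ∑ i, ‖z i + γ • (x i.succ - x i.castSucc) - p i‖ ^ 2
      + (γ * (1 - γ - t / (2 * ε)) * ∑ i : Fin m, ‖x i.succ - x i.castSucc‖ ^ 2
        + 2 * γ * t * (1 / L - ε) * ∑ i : Fin m, ‖B i (x i.castSucc) - B i q‖ ^ 2)
      ≤ ∑ i, ‖z i - p i‖ ^ 2 := by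
  have hmono : 0 ≤ ∑ j, ⟪x j - q, residual t (z - p)
      ((fun i => B i (x i.castSucc)) - fun i => B i q) (x - fun _ => q) j⟫ := by
    refine Finset.sum_nonneg fun j _ => ?_
    have h := hA j _ _ _ _ (hx j) (hp j)
    rw [← smul_sub, residual_sub, real_inner_smul_right] at h
    exact nonneg_of_mul_nonneg_right h (inv_pos.2 ht)
  have hid := sum_inner_self_residual t (z - p)
    ((fun i => B i (x i.castSucc)) - fun i => B i q) (x - fun _ => q)
  simp only [Pi.sub_apply, sub_sub_sub_cancel_right] at hid
  rw [hid] at hmono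
  -- `B i` is evaluated at entry `i` but paired with entry `i + 1`. The mismatch `r` is split off by
  -- Young's inequality with weight `ε`, at the cost of part of the cocoercivity constant.
  have hb : ∀ i : Fin m, (1 / L - ε) * ‖B i (x i.castSucc) - B i q‖ ^ 2
      - 1 / (4 * ε) * ‖x i.succ - x i.castSucc‖ ^ 2
      ≤ ⟪x i.succ - q, B i (x i.castSucc) - B i q⟫ := by
    intro i
    have h1 := hB i (x i.castSucc) q
    set b := B i (x i.castSucc) - B i q
    set r := x i.succ - x i.castSucc
    have h2 : x i.succ - q = (x i.castSucc - q) + r := by simp only [r]; abel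
    have h3 : 0 ≤ ‖ε • b + (1 / 2 : ℝ) • r‖ ^ 2 := sq_nonneg _
    rw [norm_add_sq_real, norm_smul, norm_smul, mul_pow, mul_pow, real_inner_smul_left,
      real_inner_smul_right, Real.norm_eq_abs, Real.norm_eq_abs, sq_abs, sq_abs] at h3
    rw [h2, inner_add_left, real_inner_comm b, real_inner_comm b r]
    have h4 : 0 ≤ ε * ‖b‖ ^ 2 + ⟪b, r⟫ + 1 / (4 * ε) * ‖r‖ ^ 2 := by
      have : ε * ‖b‖ ^ 2 + ⟪b, r⟫ + 1 / (4 * ε) * ‖r‖ ^ 2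
        = (ε ^ 2 * ‖b‖ ^ 2 + 2 * (ε * (1 / 2 * ⟪b, r⟫)) + (1 / 2) ^ 2 * ‖r‖ ^ 2) / ε := by
        field_simp
        ring
      rw [this]
      positivity
    linarith
  have hsum := Finset.sum_le_sum fun i (_ : i ∈ Finset.univ) => hb i
  rw [Finset.sum_sub_distrib, ← Finset.mul_sum, ← Finset.mul_sum] at hsum
  have hexp : ∑ i, ‖z i + γ • (x i.succ - x i.castSucc) - p i‖ ^ 2
      = ∑ i, ‖z i - p i‖ ^ 2 + 2 * γ * ∑ i : Fin m, ⟪x i.succ - x i.castSucc, z i - p i⟫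
        + γ ^ 2 * ∑ i : Fin m, ‖x i.succ - x i.castSucc‖ ^ 2 := by
    rw [Finset.mul_sum, Finset.mul_sum, ← Finset.sum_add_distrib, ← Finset.sum_add_distrib]
    refine Finset.sum_congr rfl fun i _ => ?_
    rw [add_sub_right_comm, norm_add_sq_real, norm_smul, mul_pow, real_inner_smul_right,
      real_inner_comm, Real.norm_eq_abs, sq_abs]
    ring
  rw [hexp]
  set R := ∑ i : Fin m, ‖x i.succ - x i.castSucc‖ ^ 2
  set Q := ∑ i : Fin m, ‖B i (x i.castSucc) - B i q‖ ^ 2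
  have h5 := mul_le_mul_of_nonneg_left hsum ht.le
  have h6 : t * ((1 / L - ε) * Q - 1 / (4 * ε) * R) = t * (1 / L - ε) * Q - t / (2 * ε) / 2 * R := by
    field_simp
    ring
  rw [h6] at h5
  have h7 : ∑ i : Fin m, ⟪x i.succ - x i.castSucc, z i - p i⟫
      ≤ -(1 / 2) * R - (t * (1 / L - ε) * Q - t / (2 * ε) / 2 * R) := by
    nlinarith [sq_nonneg ‖x (Fin.last m) - x 0‖]
  nlinarith [mul_le_mul_of_nonneg_left h7 hγ.le]

theorem tendsto_of_add_le {a d : ℕ → ℝ} (ha : ∀ k, 0 ≤ a k) (hd : ∀ k, 0 ≤ d k)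
    (h : ∀ k, a (k + 1) + d k ≤ a k) :
    (∃ c, Tendsto a atTop (𝓝 c)) ∧ Tendsto d atTop (𝓝 0) := by
  have hanti : Antitone a := antitone_nat_of_succ_le fun k => by linarith [h k, hd k]
  have hlim := tendsto_atTop_ciInf hanti ⟨0, by rintro _ ⟨k, rfl⟩; exact ha k⟩
  refine ⟨⟨_, hlim⟩, squeeze_zero hd (fun k => le_sub_iff_add_le'.2 (h k)) ?_⟩
  simpa using hlim.sub (hlim.comp (tendsto_add_atTop_nat 1))

theorem tendsto_zero_of_sum_norm_sq {ι : Type*} [Fintype ι] {E : Type*} [NormedAddCommGroup E]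
    {f : ℕ → ι → E} (h : Tendsto (fun k => ∑ i, ‖f k i‖ ^ 2) atTop (𝓝 0)) (i : ι) :
    Tendsto (fun k => f k i) atTop (𝓝 0) := by
  rw [tendsto_zero_iff_norm_tendsto_zero]
  have h1 : Tendsto (fun k => ‖f k i‖ ^ 2) atTop (𝓝 0) :=
    squeeze_zero (fun _ => sq_nonneg _)
      (fun k => Finset.single_le_sum (f := fun i => ‖f k i‖ ^ 2) (fun _ _ => sq_nonneg _)
        (Finset.mem_univ i)) h
  simpa using h1.sqrt

end Fejer

/-! ### Passing to weak limits in the inclusions. -/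

section Limit

/-- Maximality of a product of maximally monotone operators. -/
theorem mem_of_forall_sum_inner_nonneg {ι : Type*} [Fintype ι] {A : ι → H → Set H}
    (hA : ∀ j, IsMaximallyMonotone (A j)) {x a : ι → H}
    (h : ∀ y v : ι → H, (∀ j, v j ∈ A j (y j)) → 0 ≤ ∑ j, ⟪x j - y j, a j - v j⟫) (j : ι) :
    a j ∈ A j (x j) := by
  by_contra hj
  -- Indices where membership holds are tested at the point itself and contribute `0`; the others
  -- use a violating graph point, making the sum negative.
  have key : ∀ i, ∃ y v, v ∈ A i y ∧ ⟪x i - y, a i - v⟫ ≤ 0 ∧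
      (a i ∉ A i (x i) → ⟪x i - y, a i - v⟫ < 0) := by
    intro i
    by_cases hi : a i ∈ A i (x i)
    · exact ⟨x i, a i, hi, by simp, fun h' => absurd hi h'⟩
    · have : ¬ ∀ y v, v ∈ A i y → 0 ≤ ⟪x i - y, a i - v⟫ := fun h' => hi ((hA i).mem h')
      push Not at this
      obtain ⟨y, v, hv, hlt⟩ := this
      exact ⟨y, v, hv, hlt.le, fun _ => hlt⟩
  choose y v hv hle hlt using key
  have h1 := h y v hv
  have h2 : ∑ i, ⟪x i - y i, a i - v i⟫ < ∑ _i : ι, (0 : ℝ) :=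
    Finset.sum_lt_sum (fun i _ => hle i) ⟨j, Finset.mem_univ j, hlt j hj⟩
  rw [Finset.sum_const_zero] at h2
  linarith

/-- Demiclosedness of a cocoercive operator. -/
theorem IsCocoercive.eq_of_weakTendsto {ι : Type*} {F : Filter ι} [F.NeBot] {c : ℝ} (hc : 0 < c)
    {B : H → H} (hB : IsCocoercive c B) {x : ι → H} {q β : H} {R : ℝ} (hx : WeakTendsto x F q)
    (hR : ∀ᶠ k in F, ‖x k‖ ≤ R) (hβ : Tendsto (fun k => B (x k)) F (𝓝 β)) : β = B q := by
  have h1 : Tendsto (fun k => ⟪B (x k) - B q, x k⟫ - ⟪B (x k) - B q, q⟫) F (𝓝 0) := by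
    have h2 := hβ.sub_const (B q)
    simpa using (hx.inner_tendsto hR h2).sub (h2.inner (tendsto_const_nhds (x := q)))
  have h3 : Tendsto (fun k => c * ‖B (x k) - B q‖ ^ 2) F (𝓝 0) :=
    squeeze_zero (fun k => by positivity)
      (fun k => (hB (x k) q).trans_eq (inner_sub_right _ _ _)) h1
  have h4 := tendsto_nhds_unique h3 (((hβ.sub_const (B q)).norm.pow 2).const_mul c)
  have h5 : ‖β - B q‖ ^ 2 = 0 := (mul_eq_zero.1 h4.symm).resolve_left hc.ne'
  exact sub_eq_zero.1 (norm_eq_zero.1 (pow_eq_zero_iff two_ne_zero |>.1 h5))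

theorem tendsto_sub_zero_of_tendsto_succ_sub {E : Type*} [NormedAddCommGroup E] {ι : Type*}
    {F : Filter ι} {x : ι → Fin (m + 1) → E}
    (hr : ∀ i : Fin m, Tendsto (fun k => x k i.succ - x k i.castSucc) F (𝓝 0))
    (j : Fin (m + 1)) : Tendsto (fun k => x k j - x k 0) F (𝓝 0) := by
  induction j using Fin.induction with
  | zero => simpa using tendsto_const_nhds
  | succ i ih => simpa using (hr i).add ih

/-- Weak limits of the iterates are fixed points. -/
theorem isFixedPair_of_weakTendsto {A : Fin (m + 1) → H → Set H}
    (hA : ∀ j, IsMaximallyMonotone (A j)) {B : Fin m → H → H} {c t : ℝ} (hc : 0 < c)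
    (hB : ∀ i, IsCocoercive c (B i)) {ι : Type*} {F : Filter ι} [F.NeBot]
    {z : ι → Fin m → H} {x : ι → Fin (m + 1) → H} {p β : Fin m → H} {q : H} {R : ℝ}
    (hx : ∀ k j, t⁻¹ • residual t (z k) (fun i => B i (x k i.castSucc)) (x k) j ∈ A j (x k j))
    (hzR : ∀ k i, ‖z k i‖ ≤ R) (hxR : ∀ k, ‖x k 0‖ ≤ R)
    (hr : ∀ i : Fin m, Tendsto (fun k => x k i.succ - x k i.castSucc) F (𝓝 0))
    (hβ : ∀ i : Fin m, Tendsto (fun k => B i (x k i.castSucc)) F (𝓝 (β i)))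
    (hz : ∀ i, WeakTendsto (fun k => z k i) F (p i)) (hq : WeakTendsto (fun k => x k 0) F q) :
    IsFixedPair A B t p q := by
  have hd := tendsto_sub_zero_of_tendsto_succ_sub hr
  have hxq : ∀ j, WeakTendsto (fun k => x k j) F q := fun j => by
    simpa using hq.add_tendsto (hd j)
  have hxjR : ∀ j, ∀ᶠ k in F, ‖x k j‖ ≤ R + 1 := fun j => by
    filter_upwards [(hd j).norm.eventually_lt_const (by simp : ‖(0 : H)‖ < 1)] with k hk
    have := norm_add_le (x k 0) (x k j - x k 0)
    rw [add_sub_cancel] at this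
    linarith [hxR k]
  obtain rfl : β = fun i => B i q :=
    funext fun i => (hB i).eq_of_weakTendsto hc (hxq i.castSucc) (hxjR _) (hβ i)
  refine mem_of_forall_sum_inner_nonneg hA fun y v hv => ?_
  -- Only the full sum is shown to converge. Its limits are written with `q - q` to match the same
  -- identity at the constant family `q`.
  have hself : Tendsto (fun k => ∑ j, ⟪x k j, residual t (z k)
      (fun i => B i (x k i.castSucc)) (x k) j⟫) F
      (𝓝 (∑ j, ⟪q, residual t p (fun i => B i q) (fun _ => q) j⟫)) := by
    have e1 : Tendsto (fun k => ∑ i : Fin m, ⟪x k i.succ - x k i.castSucc, z k i⟫) F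
        (𝓝 (∑ i : Fin m, ⟪q - q, p i⟫)) := tendsto_finsetSum _ fun i _ => by
      simpa using (hz i).inner_tendsto (Eventually.of_forall fun k => hzR k i) (hr i)
    have e2 : Tendsto (fun k => ∑ i : Fin m, ‖x k i.succ - x k i.castSucc‖ ^ 2) F
        (𝓝 (∑ i : Fin m, ‖q - q‖ ^ 2)) := tendsto_finsetSum _ fun i _ => by
      simpa using (hr i).norm.pow 2
    have e3 : Tendsto (fun k => ∑ i : Fin m, ⟪x k i.succ, B i (x k i.castSucc)⟫) F
        (𝓝 (∑ i : Fin m, ⟪q, B i q⟫)) := tendsto_finsetSum _ fun i _ => by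
      simpa only [real_inner_comm] using (hxq i.succ).inner_tendsto (hxjR _) (hβ i)
    have e4 : Tendsto (fun k => ‖x k (Fin.last m) - x k 0‖ ^ 2) F (𝓝 (‖q - q‖ ^ 2)) := by
      simpa using (hd (Fin.last m)).norm.pow 2
    simp only [sum_inner_self_residual]
    exact ((e1.neg.sub (e4.const_mul _)).sub (e2.const_mul _)).sub (e3.const_mul _)
  have hy : Tendsto (fun k => ∑ j, ⟪y j, residual t (z k)
      (fun i => B i (x k i.castSucc)) (x k) j⟫) F
      (𝓝 (∑ j, ⟪y j, residual t p (fun i => B i q) (fun _ => q) j⟫)) := by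
    simp only [sum_inner_residual]
    exact ((((tendsto_finsetSum _ fun i _ => hz i _).neg.add (hq _)).add
      (tendsto_finsetSum _ fun i _ => hxq _ _)).sub
      ((tendsto_finsetSum _ fun i _ => tendsto_const_nhds.inner (hβ i)).const_mul _)).sub
      (tendsto_finsetSum _ fun j _ => hxq j _)
  have hv' : Tendsto (fun k => ∑ j, ⟪v j, x k j⟫) F (𝓝 (∑ j, ⟪v j, q⟫)) :=
    tendsto_finsetSum _ fun j _ => hxq j _
  have hlim := (((hself.sub hy).const_mul t⁻¹).sub hv').add_const (∑ j, ⟪y j, v j⟫)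
  have hsplit : ∀ x' a : Fin (m + 1) → H, ∑ j, ⟪x' j - y j, t⁻¹ • a j - v j⟫
      = t⁻¹ * (∑ j, ⟪x' j, a j⟫ - ∑ j, ⟪y j, a j⟫) - ∑ j, ⟪v j, x' j⟫ + ∑ j, ⟪y j, v j⟫ := by
    intro x' a
    simp only [inner_sub_left, inner_sub_right, real_inner_smul_right, Finset.sum_sub_distrib,
      ← Finset.mul_sum, real_inner_comm (v _) (x' _)]
    ring
  rw [hsplit (fun _ => q)]
  refine ge_of_tendsto' hlim fun k => ?_
  rw [← hsplit]
  exact Finset.sum_nonneg fun j _ => (hA j).1 _ _ _ _ (hx k j) (hv j)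

end Limit

/-! ### Weak convergence in the product space, coordinatewise. -/

section Coordinates

variable {ι : Type*} {n : ℕ}

theorem WeakTendsto.apply {f : ι → Power H n} {F : Filter ι} {l : Power H n}
    (h : WeakTendsto f F l) (i : Fin n) : WeakTendsto (fun k => f k i) F (l i) := fun v => by
  have := h (WithLp.toLp 2 (Pi.single i v))
  have h1 : ∀ w : Power H n, ⟪WithLp.toLp 2 (Pi.single i v), w⟫ = ⟪v, w i⟫ := fun w => by
    rw [PiLp.inner_apply, Finset.sum_eq_single i (fun j _ hj => by simp [hj])
      (fun hi => absurd (Finset.mem_univ i) hi)]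
    simp
  simpa only [h1] using this

theorem weakTendsto_of_apply {f : ι → Power H n} {F : Filter ι} {l : Power H n}
    (h : ∀ i, WeakTendsto (fun k => f k i) F (l i)) : WeakTendsto f F l := fun v => by
  simp only [PiLp.inner_apply]
  exact tendsto_finsetSum _ fun i _ => h i _

end Coordinates

end DFB

/-- Here `n = m + 1 ≥ 2`: there are `m + 1` set-valued operators `A i` and `m` cocoercive
operators `B i`, and `(z^k)` lives in `H ^ m`, `(x^k)` in `H ^ (m + 1)`. -/
theorem mainTheorem1 {H : Type*} [NormedAddCommGroup H] [InnerProductSpace ℝ H]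
    [CompleteSpace H] (m : ℕ) (hm : 1 ≤ m)
    (A : Fin (m + 1) → H → Set H) (hA : ∀ i, DFB.IsMaximallyMonotone (A i))
    (L : ℝ) (hL : 0 < L)
    (B : Fin m → H → H) (hB : ∀ i, DFB.IsCocoercive (1 / L) (B i))
    (hzer : (DFB.zer (DFB.sumOperator A B)).Nonempty)
    (lam : ℝ) (hlam : lam ∈ Set.Ioo 0 (2 / L))
    (γ : ℝ) (hγ : γ ∈ Set.Ioo 0 (1 - lam * L / 2))
    (z0 : DFB.Power H m) :
    (∃! s : (ℕ → DFB.Power H m) × (ℕ → DFB.Power H (m + 1)),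
      DFB.IsGenerated A B lam γ z0 s.1 s.2) ∧
    ∀ (z : ℕ → DFB.Power H m) (x : ℕ → DFB.Power H (m + 1)),
      DFB.IsGenerated A B lam γ z0 z x →
      (∃ zlim ∈ DFB.fix (DFB.T A B lam γ), DFB.ConvergesWeakly z zlim) ∧
      (∃ xlim ∈ DFB.zer (DFB.sumOperator A B),
        DFB.ConvergesWeakly x (WithLp.toLp 2 (fun _ : Fin (m + 1) => xlim)) ∧
        ∀ i : Fin m,
          Filter.Tendsto (fun k => B i (x k i.castSucc)) Filter.atTop (𝓝 (B i xlim))) := by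
  open DFB Filter in
  have ht : 0 < lam := hlam.1
  refine ⟨existsUnique_isGenerated hA hm B ht γ z0, fun z x hgen => ?_⟩
  have hstep : ∀ k, ∀ j, lam⁻¹ • residual lam (fun i => z k i)
      (fun i => B i (x k i.castSucc)) (fun j => x k j) j ∈ A j (x k j) :=
    fun k => (isResolventStep_iff hm ht).1 (hgen.resolvent_step k)
  have hupd : ∀ k i, z (k + 1) i = z k i + γ • (x k i.succ - x k i.castSucc) := fun k i => by
    rw [hgen.update_step k]
    simp [update]
  have h1γ : 0 < 1 - γ := by
    have : 0 < lam * L := mul_pos ht hL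
    linarith [hγ.2]
  -- The interval is nonempty precisely because `γ < 1 - lam * L / 2`; its two ends make the two
  -- Fejér coefficients positive.
  obtain ⟨ε, hε1, hε2⟩ : ∃ ε, lam / (2 * (1 - γ)) < ε ∧ ε < 1 / L := by
    refine exists_between ?_
    rw [div_lt_div_iff₀ (by positivity) hL]
    linarith [hγ.2]
  have hε : 0 < ε := lt_trans (by positivity) hε1
  have hc1 : 0 < γ * (1 - γ - lam / (2 * ε)) := by
    refine mul_pos hγ.1 (sub_pos.2 ?_)
    rw [div_lt_iff₀ (by positivity)] at hε1 ⊢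
    linarith
  have hc2 : 0 < 2 * γ * lam * (1 / L - ε) :=
    mul_pos (mul_pos (mul_pos two_pos hγ.1) ht) (sub_pos.2 hε2)
  have hfejer : ∀ (p : Power H m) (q : H), IsFixedPair A B lam (fun i => p i) q →
      (∃ c, Tendsto (fun k => ‖z k - p‖ ^ 2) atTop (𝓝 c)) ∧
      Antitone (fun k => ‖z k - p‖ ^ 2) ∧
      (∀ i : Fin m, Tendsto (fun k => x k i.succ - x k i.castSucc) atTop (𝓝 0)) ∧
      ∀ i : Fin m, Tendsto (fun k => B i (x k i.castSucc)) atTop (𝓝 (B i q)) := by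
    intro p q hpq
    have hle := fun k => sum_norm_update_sub_sq_le (fun j => (hA j).1) hB ht hγ.1 hε (hstep k) hpq
    simp only [← hupd] at hle
    have hnorm : ∀ k, ‖z k - p‖ ^ 2 = ∑ i, ‖z k i - p i‖ ^ 2 := fun k => by
      rw [PiLp.norm_sq_eq_of_L2]
      rfl
    simp only [← hnorm] at hle
    have hR0 : ∀ k, 0 ≤ ∑ i : Fin m, ‖x k i.succ - x k i.castSucc‖ ^ 2 :=
      fun k => Finset.sum_nonneg fun _ _ => sq_nonneg _
    have hQ0 : ∀ k, 0 ≤ ∑ i : Fin m, ‖B i (x k i.castSucc) - B i q‖ ^ 2 :=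
      fun k => Finset.sum_nonneg fun _ _ => sq_nonneg _
    have hd0 := fun k => add_nonneg (mul_nonneg hc1.le (hR0 k)) (mul_nonneg hc2.le (hQ0 k))
    obtain ⟨hconv, hd⟩ := tendsto_of_add_le (fun k => sq_nonneg ‖z k - p‖) hd0 hle
    refine ⟨hconv, antitone_nat_of_succ_le fun k => by linarith [hle k, hd0 k], ?_, fun i => ?_⟩
    · refine tendsto_zero_of_sum_norm_sq (f := fun k (i : Fin m) => x k i.succ - x k i.castSucc) ?_
      have := (squeeze_zero (fun k => mul_nonneg hc1.le (hR0 k))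
        (fun k => le_add_of_nonneg_right (mul_nonneg hc2.le (hQ0 k))) hd).const_mul
          (γ * (1 - γ - lam / (2 * ε)))⁻¹
      simpa only [inv_mul_cancel_left₀ hc1.ne', mul_zero] using this
    · have := (squeeze_zero (fun k => mul_nonneg hc2.le (hQ0 k))
        (fun k => le_add_of_nonneg_left (mul_nonneg hc1.le (hR0 k))) hd).const_mul
          (2 * γ * lam * (1 / L - ε))⁻¹
      simp only [inv_mul_cancel_left₀ hc2.ne', mul_zero] at this
      exact tendsto_sub_nhds_zero_iff.1 (tendsto_zero_of_sum_norm_sq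
        (f := fun k (i : Fin m) => B i (x k i.castSucc) - B i q) this i)
  obtain ⟨q₀, hq₀⟩ := hzer
  obtain ⟨p₀, hp₀⟩ := exists_isFixedPair hq₀ hm ht
  obtain ⟨-, hanti, hr, hβ⟩ := hfejer (WithLp.toLp 2 p₀) q₀ hp₀
  have hzd : ∀ k, ‖z k - WithLp.toLp 2 p₀‖ ≤ ‖z 0 - WithLp.toLp 2 p₀‖ := fun k =>
    pow_le_pow_iff_left₀ (norm_nonneg _) (norm_nonneg _) two_ne_zero |>.1 (hanti (Nat.zero_le k))
  obtain ⟨R, hzR⟩ : ∃ R, ∀ k, ‖z k‖ ≤ R :=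
    ⟨_, fun k => (norm_le_norm_sub_add _ (WithLp.toLp 2 p₀)).trans (add_le_add_left (hzd k) _)⟩
  have hziR : ∀ k i, ‖z k i‖ ≤ R := fun k i => (PiLp.norm_apply_le _ i).trans (hzR k)
  let i₀ : Fin m := ⟨0, hm⟩
  have hi₀ : i₀.castSucc = 0 := rfl
  have hx0 : ∀ k, x k 0 ∈ resolventOp lam (A 0) (z k i₀) :=
    fun k => (hgen.resolvent_step k).first i₀ rfl
  obtain ⟨R', hxR⟩ : ∃ R', ∀ k, ‖x k 0‖ ≤ R' := by
    refine ⟨2 * R + ‖x 0 0‖, fun k => ?_⟩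
    have h1 := (hA 0).1.resolventOp_norm_sub_le ht (hx0 k) (hx0 0)
    have h2 := norm_sub_le (z k i₀) (z 0 i₀)
    have h3 := norm_le_norm_sub_add (x k 0) (x 0 0)
    linarith [hziR k i₀, hziR 0 i₀]
  have hcluster : ∀ (U : Ultrafilter ℕ) (p : Power H m) (q : H), ↑U ≤ (atTop : Filter ℕ) →
      WeakTendsto z U p → WeakTendsto (fun k => x k 0) U q →
      IsFixedPair A B lam (fun i => p i) q := fun U p q hU hp hq =>
    isFixedPair_of_weakTendsto hA (one_div_pos.2 hL) hB (R := max R R')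
      (x := fun k j => x k j) hstep
      (fun k i => (hziR k i).trans (le_max_left _ _)) (fun k => (hxR k).trans (le_max_right _ _))
      (fun i => (hr i).mono_left hU) (fun i => (hβ i).mono_left hU) (fun i => hp.apply i) hq
  obtain ⟨zlim, ⟨xlim, hpair⟩, hzlim⟩ := exists_weakTendsto_of_tendsto_norm_sub z
    {p | ∃ q, IsFixedPair A B lam (fun i => p i) q} hzR
    (fun p ⟨q, hpq⟩ => (hfejer p q hpq).1) (fun U p hU hp => by
      obtain ⟨q, hq⟩ := exists_weakTendsto_ultrafilter U (fun k => x k 0) hxR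
      exact ⟨q, hcluster U p q hU hp hq⟩)
  -- The limit `zlim` determines its partner `q` through the first resolvent, so all cluster points
  -- of `x k 0` coincide.
  have hres : ∀ q, IsFixedPair A B lam (fun i => zlim i) q →
      q ∈ resolventOp lam (A 0) (zlim i₀) := fun q hq =>
    ((isResolventStep_iff (x := WithLp.toLp 2 fun _ => q) hm ht).2 hq).first i₀ rfl
  have hx0lim : WeakTendsto (fun k => x k 0) atTop xlim := by
    refine weakTendsto_iff_ultrafilter.2 fun U hU => ?_
    obtain ⟨q, hq⟩ := exists_weakTendsto_ultrafilter U (fun k => x k 0) hxR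
    have hq' := hcluster U zlim q hU (hzlim.mono hU) hq
    rwa [(hA 0).1.resolventOp_unique ht (hres _ hpair) (hres _ hq')]
  refine ⟨⟨zlim, hpair.mem_fix hm ht γ, (convergesWeakly_iff _ _).2 hzlim⟩,
    xlim, hpair.mem_zer ht, (convergesWeakly_iff _ _).2 ?_, (hfejer zlim xlim hpair).2.2.2⟩
  -- The remaining entries differ from the first by a strongly null sequence.
  refine weakTendsto_of_apply fun j => ?_
  simpa using hx0lim.add_tendsto
    (tendsto_sub_zero_of_tendsto_succ_sub (x := fun k j => x k j) hr j)
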